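/- For positive integers $n, m$ and a family $\mathcal F$ of graphs, let $\mathrm{ex}(n,m,\mathcal F)$ denote the maximum number of edges of a bipartite graph with parts of sizes $n$ and $m$ that contains no member of $\mathcal F$ as a (not necessarily induced) subgraph. Let $C_4$ be the cycle of length $4$, and let $\theta_{3,3}$ be the graph consisting of two vertices joined by $3$ internally vertex-disjoint paths of length $3$. Then $$\mathrm{ex}(n, n^{2/3}, \{C_4, \theta_{3,3}\}) = \Theta(n^{1+1/9}),$$ that is, there are constants $c, C > 0$ such that for every positive integer $n$, and for both $m = \lfloor n^{2/3} \rfloor$ and $m = \lceil n^{2/3} \rceil$, $$c\, n^{1+1/9} \le \mathrm{ex}(n, m, \{C_4, \theta_{3,3}\}) \le C\, n^{1+1/9}.$$ -/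

import Mathlib

namespace BipartiteTuran

/-- The `s`-th vertex (`0 ≤ s ≤ k`) of the `i`-th of `t` paths of length `k` that share their two
end vertices `inl 0`, `inl 1` and nothing else: `inr (i, s - 1)` is the `s`-th vertex of the
`i`-th path for `0 < s < k`. -/
def thetaVertex (k t : ℕ) (i : Fin t) (s : ℕ) : Fin 2 ⊕ (Fin t × Fin (k - 1)) :=
  if h : 0 < s ∧ s < k then Sum.inr (i, ⟨s - 1, by omega⟩)
  else if s = 0 then Sum.inl 0 else Sum.inl 1

/-- The theta graph `θ_{k,t}` (for `k, t ≥ 1`): two vertices joined by `t` internally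
vertex-disjoint paths of length `k`. -/
def thetaGraph (k t : ℕ) : SimpleGraph (Fin 2 ⊕ (Fin t × Fin (k - 1))) :=
  SimpleGraph.fromRel fun u v =>
    ∃ i : Fin t, ∃ s : ℕ, s < k ∧ u = thetaVertex k t i s ∧ v = thetaVertex k t i (s + 1)

open scoped Classical in
/-- The bipartite Turán number `ex(n, m, F)`: the maximum number of edges of a bipartite graph with
parts of sizes `n` and `m` that contains no graph of the family `F` as a (not necessarily
induced) subgraph. -/
noncomputable def ex (n m : ℕ) (F : Set (Σ W : Type, SimpleGraph W)) : ℕ :=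
  (Finset.univ.filter fun G : SimpleGraph (Fin n ⊕ Fin m) =>
      G ≤ completeBipartiteGraph (Fin n) (Fin m) ∧ ∀ H ∈ F, H.2.Free G).sup
    fun G => G.edgeFinset.card

end BipartiteTuran

namespace BipartiteTuran

open Finset Function

/-! Upper bound: count paths with three edges. By `C₄`-freeness, two distinct such paths with the
same ends are internally disjoint, so `θ₃₃`-freeness allows at most two per pair of ends, hence at
most `2nm` in all. An edge is the middle of `(d(a) - 1)(d(b) - 1)` paths, and at least half of the
edges have both degrees at least a quarter of the average on their side. So `e · (e/n)(e/m) = O(nm)`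
unless `e = O(n + m)`, which gives `e = O((nm)^(2/3)) = O(n^(10/9))` (`card_pow_three_le`).

Lower bound: an algebraic graph over `ZMod p` with `p⁹` left vertices, at most `p⁶` right vertices
and about `p¹⁰/2` edges (`normIncidence`). Along a path `a - x - y - b`, eliminating `y` leaves a
quadratic equation for the parameter `s` of `x`, with coefficients depending only on `a` and `b`.
Three paths give three roots, so the quadratic vanishes identically. Two of its coefficients then
yield zeros of the anisotropic form `x² - r y²`, which forces `y = a` (`normIncidence_thetaFree`).
Bertrand's postulate supplies `p` of order `n^(1/9)`. -/

/-- No two distinct elements of `α` have two common neighbours. -/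
def RectangleFree {α β : Type*} (R : α → β → Prop) : Prop :=
  ∀ a a' b b', R a b → R a b' → R a' b → R a' b' → a = a' ∨ b = b'

/-- No `a : α` and `b : β` are joined by three disjoint paths of length three. -/
def ThetaFree {α β : Type*} (R : α → β → Prop) : Prop :=
  ∀ a b (x : Fin 3 → β) (y : Fin 3 → α), Injective x → Injective y →
    (∀ i, x i ≠ b ∧ y i ≠ a ∧ R a (x i) ∧ R (y i) (x i) ∧ R (y i) b) → False

/-- The bipartite graph of a relation. -/
def relGraph {α β : Type*} (R : α → β → Prop) : SimpleGraph (α ⊕ β) where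
  Adj u v := ∃ a b, R a b ∧ ((u = Sum.inl a ∧ v = Sum.inr b) ∨ (u = Sum.inr b ∧ v = Sum.inl a))
  symm := ⟨by rintro u v ⟨a, b, h, h' | h'⟩ <;> exact ⟨a, b, h, by tauto⟩⟩
  loopless := ⟨by rintro u ⟨a, b, h, ⟨h1, h2⟩ | ⟨h1, h2⟩⟩ <;> simp [h1] at h2⟩

/-! ### Translation between forbidden subgraphs and relations. -/

section relGraph

variable {α β : Type*} {R : α → β → Prop}

theorem relGraph_le : relGraph R ≤ completeBipartiteGraph α β := by
  rintro u v ⟨a, b, -, ⟨rfl, rfl⟩ | ⟨rfl, rfl⟩⟩ <;> simp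

theorem relGraph_adj_inl {a : α} {v : α ⊕ β} (h : (relGraph R).Adj (Sum.inl a) v) :
    ∃ b, v = Sum.inr b ∧ R a b := by
  obtain ⟨a', b, h, ⟨h1, h2⟩ | ⟨h1, h2⟩⟩ := h
  · exact ⟨b, h2, Sum.inl_injective h1 ▸ h⟩
  · simp at h1

theorem relGraph_adj_inr {b : β} {v : α ⊕ β} (h : (relGraph R).Adj (Sum.inr b) v) :
    ∃ a, v = Sum.inl a ∧ R a b := by
  obtain ⟨a, b', h, ⟨h1, h2⟩ | ⟨h1, h2⟩⟩ := h
  · simp at h1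
  · exact ⟨a, h2, Sum.inr_injective h1 ▸ h⟩

theorem relGraph_adj {a : α} {b : β} :
    (relGraph R).Adj (Sum.inl a) (Sum.inr b) ↔ R a b := by
  refine ⟨fun h => ?_, fun h => ⟨a, b, h, Or.inl ⟨rfl, rfl⟩⟩⟩
  obtain ⟨b', hb, h⟩ := relGraph_adj_inl h
  exact Sum.inr_injective hb ▸ h

theorem relGraph_cycleGraph_free (h : RectangleFree R) :
    (SimpleGraph.cycleGraph 4).Free (relGraph R) := by
  rintro ⟨f⟩
  have e : ∀ i j, (SimpleGraph.cycleGraph 4).Adj i j → (relGraph R).Adj (f i) (f j) :=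
    fun i j hij => f.toHom.map_adj hij
  have e01 := e 0 1 (by decide)
  have e12 := e 1 2 (by decide)
  have e23 := e 2 3 (by decide)
  have e30 := e 3 0 (by decide)
  have h02 : f 0 ≠ f 2 := fun h => absurd (f.injective h) (by decide)
  have h13 : f 1 ≠ f 3 := fun h => absurd (f.injective h) (by decide)
  rcases h0 : f 0 with a | b
  · rw [h0] at e01 e30
    obtain ⟨b, h1, r1⟩ := relGraph_adj_inl e01
    obtain ⟨b', h3, r2⟩ := relGraph_adj_inl e30.symm
    rw [h1] at e12
    rw [h3] at e23
    obtain ⟨a', h2, r3⟩ := relGraph_adj_inr e12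
    rw [h2] at e23
    rcases h a a' b b' r1 r2 r3 (relGraph_adj.1 e23) with rfl | rfl
    · exact h02 (h0.trans h2.symm)
    · exact h13 (h1.trans h3.symm)
  · rw [h0] at e01 e30
    obtain ⟨a, h1, r1⟩ := relGraph_adj_inr e01
    obtain ⟨a', h3, r2⟩ := relGraph_adj_inr e30.symm
    rw [h1] at e12
    rw [h3] at e23
    obtain ⟨b', h2, r3⟩ := relGraph_adj_inl e12
    rw [h2] at e23
    rcases h a a' b b' r1 r3 r2 (relGraph_adj.1 e23.symm) with rfl | rfl
    · exact h13 (h1.trans h3.symm)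
    · exact h02 (h0.trans h2.symm)

theorem thetaGraph_adj_left (i : Fin 3) :
    (thetaGraph 3 3).Adj (Sum.inl 0) (Sum.inr (i, 0)) :=
  ⟨by simp, Or.inl ⟨i, 0, by simp [thetaVertex]⟩⟩

theorem thetaGraph_adj_middle (i : Fin 3) :
    (thetaGraph 3 3).Adj (Sum.inr (i, 0)) (Sum.inr (i, 1)) :=
  ⟨by simp, Or.inl ⟨i, 1, by simp [thetaVertex]⟩⟩

theorem thetaGraph_adj_right (i : Fin 3) :
    (thetaGraph 3 3).Adj (Sum.inr (i, 1)) (Sum.inl 1) :=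
  ⟨by simp, Or.inl ⟨i, 2, by simp [thetaVertex]⟩⟩

/-- The ends of `θ₃₃` are at odd distance, so they lie on opposite sides; if the first end lies in
`β`, the paths are read backwards. -/
theorem relGraph_thetaGraph_free (h : ThetaFree R) : (thetaGraph 3 3).Free (relGraph R) := by
  rintro ⟨f⟩
  have e1 : ∀ i, (relGraph R).Adj (f (Sum.inl 0)) (f (Sum.inr (i, 0))) :=
    fun i => f.toHom.map_adj (thetaGraph_adj_left i)
  have e2 : ∀ i, (relGraph R).Adj (f (Sum.inr (i, 0))) (f (Sum.inr (i, 1))) :=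
    fun i => f.toHom.map_adj (thetaGraph_adj_middle i)
  have e3 : ∀ i, (relGraph R).Adj (f (Sum.inr (i, 1))) (f (Sum.inl 1)) :=
    fun i => f.toHom.map_adj (thetaGraph_adj_right i)
  have hf : ∀ u v, f u = f v → u = v := fun u v h => f.injective h
  rcases h0 : f (Sum.inl 0) with a | b
  · simp only [h0] at e1
    choose x hx r1 using fun i => relGraph_adj_inl (e1 i)
    simp only [hx] at e2
    choose y hy r2 using fun i => relGraph_adj_inr (e2 i)
    simp only [hy] at e3
    obtain ⟨b, hb, -⟩ := relGraph_adj_inl (e3 0)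
    simp only [hb] at e3
    refine h a b x y (fun i j hij => ?_) (fun i j hij => ?_)
      fun i => ⟨fun h => ?_, fun h => ?_, r1 i, r2 i, relGraph_adj.1 (e3 i)⟩
    · simpa using hf (Sum.inr (i, 0)) (Sum.inr (j, 0)) (by rw [hx, hx, hij])
    · simpa using hf (Sum.inr (i, 1)) (Sum.inr (j, 1)) (by rw [hy, hy, hij])
    · simpa using hf (Sum.inr (i, 0)) (Sum.inl 1) (by rw [hx, hb, h])
    · simpa using hf (Sum.inr (i, 1)) (Sum.inl 0) (by rw [hy, h0, h])
  · simp only [h0] at e1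
    choose y hy r1 using fun i => relGraph_adj_inr (e1 i)
    simp only [hy] at e2
    choose x hx r2 using fun i => relGraph_adj_inl (e2 i)
    simp only [hx] at e3
    obtain ⟨a, ha, -⟩ := relGraph_adj_inr (e3 0)
    simp only [ha] at e3
    refine h a b x y (fun i j hij => ?_) (fun i j hij => ?_)
      fun i => ⟨fun h => ?_, fun h => ?_, relGraph_adj.1 (e3 i).symm, r2 i, r1 i⟩
    · simpa using hf (Sum.inr (i, 1)) (Sum.inr (j, 1)) (by rw [hx, hx, hij])
    · simpa using hf (Sum.inr (i, 0)) (Sum.inr (j, 0)) (by rw [hy, hy, hij])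
    · simpa using hf (Sum.inr (i, 1)) (Sum.inl 0) (by rw [hx, h0, h])
    · simpa using hf (Sum.inr (i, 0)) (Sum.inl 1) (by rw [hy, ha, h])

end relGraph

section adj

variable {α β : Type*} {G : SimpleGraph (α ⊕ β)}

theorem rectangleFree_of_free (hG : (SimpleGraph.cycleGraph 4).Free G) :
    RectangleFree fun (a : α) (b : β) => G.Adj (Sum.inl a) (Sum.inr b) := by
  intro a a' b b' h1 h2 h3 h4
  by_contra! hne
  refine hG ⟨⟨⟨![Sum.inl a, Sum.inr b, Sum.inl a', Sum.inr b'], ?_⟩, ?_⟩⟩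
  · intro i j hij
    fin_cases i <;> fin_cases j <;>
      first
      | exact absurd hij (by decide)
      | simp [h1, h2, h3, h4, G.adj_comm (Sum.inr _)]
  · intro i j hij
    have := hne.1.symm
    have := hne.2.symm
    fin_cases i <;> fin_cases j <;> simp_all

theorem thetaFree_of_free (hG : (thetaGraph 3 3).Free G) :
    ThetaFree fun (a : α) (b : β) => G.Adj (Sum.inl a) (Sum.inr b) := by
  intro a b x y hx hy h
  let φ : Fin 2 ⊕ (Fin 3 × Fin (3 - 1)) → α ⊕ β := Sum.elim ![Sum.inl a, Sum.inr b]
    fun p => if p.2 = 0 then Sum.inr (x p.1) else Sum.inl (y p.1)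
  have key : ∀ (i : Fin 3) (s : ℕ), s < 3 →
      G.Adj (φ (thetaVertex 3 3 i s)) (φ (thetaVertex 3 3 i (s + 1))) := by
    intro i s hs
    obtain ⟨-, -, h1, h2, h3⟩ := h i
    interval_cases s
    · simpa [thetaVertex, φ] using h1
    · simpa [thetaVertex, φ] using h2.symm
    · simpa [thetaVertex, φ] using h3
  refine hG ⟨⟨⟨φ, ?_⟩, ?_⟩⟩
  · rintro u v ⟨-, ⟨i, s, hs, rfl, rfl⟩ | ⟨i, s, hs, rfl, rfl⟩⟩
    · exact key i s hs
    · exact (key i s hs).symm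
  · have hxb : ∀ i, x i ≠ b := fun i => (h i).1
    have hya : ∀ i, y i ≠ a := fun i => (h i).2.1
    have hxb' : ∀ i, b ≠ x i := fun i => (h i).1.symm
    have hya' : ∀ i, a ≠ y i := fun i => (h i).2.1.symm
    rintro (u | ⟨i, u⟩) (v | ⟨j, v⟩) huv <;> fin_cases u <;> fin_cases v <;>
      simp_all [φ, hx.eq_iff, hy.eq_iff]

end adj

/-- The family `{C₄, θ₃₃}`. -/
abbrev cycleThetaFamily : Set (Σ W : Type, SimpleGraph W) :=
  {⟨_, SimpleGraph.cycleGraph 4⟩, ⟨_, thetaGraph 3 3⟩}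

open scoped Classical in
theorem card_edgeFinset_of_le_completeBipartiteGraph {α β : Type*} [Fintype α] [Fintype β]
    {G : SimpleGraph (α ⊕ β)} (hG : G ≤ completeBipartiteGraph α β) :
    #G.edgeFinset = #{p : α × β | G.Adj (Sum.inl p.1) (Sum.inr p.2)} := by
  symm
  refine card_bij (fun p _ => s(Sum.inl p.1, Sum.inr p.2)) ?_ ?_ ?_
  · intro p hp
    simpa using hp
  · rintro ⟨a, b⟩ - ⟨a', b'⟩ - h
    simpa using h
  · intro e he
    induction e with | h u v => ?_
    rw [SimpleGraph.mem_edgeFinset, SimpleGraph.mem_edgeSet] at he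
    have := hG he
    rcases u with a | b <;> rcases v with a' | b'
    · simp at this
    · exact ⟨(a, b'), by simpa using he, rfl⟩
    · exact ⟨(a', b), by simpa using he.symm, Sym2.eq_swap⟩
    · simp at this

open scoped Classical in
theorem ex_le_of_forall {n m k : ℕ}
    (h : ∀ R : Fin n → Fin m → Prop, RectangleFree R → ThetaFree R →
      #{p : Fin n × Fin m | R p.1 p.2} ≤ k) :
    ex n m cycleThetaFamily ≤ k := by
  refine Finset.sup_le fun G hG => ?_
  rw [mem_filter] at hG
  obtain ⟨-, hG, hF⟩ := hG
  have := h _ (rectangleFree_of_free (hF _ (Or.inl rfl))) (thetaFree_of_free (hF _ (Or.inr rfl)))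
  rw [← card_edgeFinset_of_le_completeBipartiteGraph hG] at this
  convert this

open scoped Classical in
theorem card_le_ex_fin {n m : ℕ} {R : Fin n → Fin m → Prop}
    (h4 : RectangleFree R) (h3 : ThetaFree R) :
    #{p : Fin n × Fin m | R p.1 p.2} ≤ ex n m cycleThetaFamily := by
  have h : (relGraph R) ∈ Finset.univ.filter fun G : SimpleGraph (Fin n ⊕ Fin m) =>
      G ≤ completeBipartiteGraph (Fin n) (Fin m) ∧ ∀ H ∈ cycleThetaFamily, H.2.Free G := by
    rw [mem_filter]
    refine ⟨mem_univ _, relGraph_le, ?_⟩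
    rintro H (rfl | rfl)
    · exact relGraph_cycleGraph_free h4
    · exact relGraph_thetaGraph_free h3
  have := Finset.le_sup (f := fun G : SimpleGraph (Fin n ⊕ Fin m) => #G.edgeFinset) h
  rw [card_edgeFinset_of_le_completeBipartiteGraph relGraph_le] at this
  simp only [relGraph_adj] at this
  unfold ex
  convert this

open scoped Classical in
-- Padding with isolated vertices creates no forbidden subgraph, since every vertex of a `C₄` or
-- `θ₃₃` has an edge and so lies in the image of the embedding.
theorem card_le_ex {α β : Type*} [Fintype α] [Fintype β] {n m : ℕ} {R : α → β → Prop}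
    (hα : Fintype.card α ≤ n) (hβ : Fintype.card β ≤ m)
    (h4 : RectangleFree R) (h3 : ThetaFree R) :
    #{p : α × β | R p.1 p.2} ≤ ex n m cycleThetaFamily := by
  obtain ⟨f⟩ : Nonempty (α ↪ Fin n) := Function.Embedding.nonempty_of_card_le (by simpa using hα)
  obtain ⟨g⟩ : Nonempty (β ↪ Fin m) := Function.Embedding.nonempty_of_card_le (by simpa using hβ)
  let S : Fin n → Fin m → Prop := fun i j => ∃ a b, f a = i ∧ g b = j ∧ R a b
  have hS : ∀ a b, S (f a) (g b) ↔ R a b := by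
    refine fun a b => ⟨?_, fun h => ⟨a, b, rfl, rfl, h⟩⟩
    rintro ⟨a', b', h1, h2, h⟩
    rwa [← f.injective h1, ← g.injective h2]
  have hS4 : RectangleFree S := by
    rintro i i' j j' ⟨a, b, rfl, rfl, r1⟩ r2 ⟨a', b1, rfl, hb1, r3⟩ r4
    obtain ⟨a2, b', -, rfl, -⟩ := id r2
    obtain rfl := g.injective hb1
    rw [hS] at r2 r4
    exact (h4 a a' b1 b' r1 r2 r3 r4).imp (congrArg f) (congrArg g)
  have hS3 : ThetaFree S := by
    intro i j x y hx hy h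
    obtain ⟨a, -, rfl, -, -⟩ := (h 0).2.2.1
    obtain ⟨-, b, -, rfl, -⟩ := (h 0).2.2.2.2
    choose y' x' hy' hx' _ using fun i => (h i).2.2.2.1
    refine h3 a b x' y' (fun i j e => hx ?_) (fun i j e => hy ?_) fun i => ?_
    · rw [← hx', ← hx', e]
    · rw [← hy', ← hy', e]
    · have := h i
      rw [← hx', ← hy', hS, hS, hS] at this
      exact ⟨fun e => this.1 (by rw [e]), fun e => this.2.1 (by rw [e]), this.2.2⟩
  refine le_trans ?_ (card_le_ex_fin hS4 hS3)
  refine card_le_card_of_injOn (fun p => (f p.1, g p.2)) (fun p hp => ?_) ?_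
  · simpa [hS] using hp
  · rintro ⟨a, b⟩ - ⟨a', b'⟩ - h
    simpa using h

/-! ### The upper bound: counting paths of length three. -/

open scoped Classical in
theorem card_paths_le_two {α β : Type*} [Fintype α] [Fintype β] {R : α → β → Prop}
    (h4 : RectangleFree R) (h3 : ThetaFree R) (a : α) (b : β) :
    #{p : α × β | p.2 ≠ b ∧ p.1 ≠ a ∧ R a p.2 ∧ R p.1 p.2 ∧ R p.1 b} ≤ 2 := by
  by_contra! hlt
  obtain ⟨f, hf⟩ : ∃ f : Fin 3 → α × β, Injective f ∧
      ∀ i, f i ∈ ({p : α × β | p.2 ≠ b ∧ p.1 ≠ a ∧ R a p.2 ∧ R p.1 p.2 ∧ R p.1 b} : Finset _) := by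
    obtain ⟨p, q, r, hp, hq, hr, h1, h2, h3⟩ := two_lt_card_iff.1 hlt
    refine ⟨![p, q, r], ?_, ?_⟩
    · intro i j hij
      fin_cases i <;> fin_cases j <;> simp_all
    · intro i
      fin_cases i
      exacts [hp, hq, hr]
  obtain ⟨hinj, hf⟩ := hf
  simp only [mem_filter, mem_univ, true_and] at hf
  -- Two paths sharing one inner vertex share the other as well, since otherwise they would close up
  -- to a 4-cycle.
  refine h3 a b (fun i => (f i).2) (fun i => (f i).1) (fun i j hij => hinj ?_)
    (fun i j hij => hinj ?_) hf
  · obtain ⟨h1, h2, h3, h5, h6⟩ := hf i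
    obtain ⟨k1, k2, k3, k5, k6⟩ := hf j
    simp only at hij
    refine Prod.ext ((h4 _ _ _ b h5 h6 (hij ▸ k5) k6).resolve_right h1) hij
  · obtain ⟨h1, h2, h3, h5, h6⟩ := hf i
    obtain ⟨k1, k2, k3, k5, k6⟩ := hf j
    simp only at hij
    refine Prod.ext hij ((h4 a _ _ _ h3 k3 h5 (hij ▸ k5)).resolve_left h2.symm)

open scoped Classical in
-- Double counting of three-edge paths: by middle edge on the left, by pair of ends on the right.
theorem sum_degree_sub_one_le {α β : Type*} [Fintype α] [Fintype β] {R : α → β → Prop}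
    (h4 : RectangleFree R) (h3 : ThetaFree R) :
    ∑ p : α × β with R p.1 p.2, (#{b | R p.1 b} - 1) * (#{a | R a p.2} - 1) ≤
      2 * (Fintype.card α * Fintype.card β) := by
  have h1 : ∀ p ∈ ({p : α × β | R p.1 p.2} : Finset (α × β)),
      (#{b | R p.1 b} - 1) * (#{a | R a p.2} - 1) =
        #{q : α × β | p.2 ≠ q.2 ∧ p.1 ≠ q.1 ∧ R q.1 p.2 ∧ R p.1 p.2 ∧ R p.1 q.2} := by
    intro p hp
    simp only [mem_filter, mem_univ, true_and] at hp
    rw [← card_erase_of_mem (a := p.2) (by simpa using hp),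
      ← card_erase_of_mem (a := p.1) (by simpa using hp), mul_comm, ← card_product]
    congr 1
    ext q
    simp only [mem_product, mem_erase, mem_filter, mem_univ, true_and]
    simp only [hp, true_and, ne_comm (a := p.1), ne_comm (a := p.2)]
    tauto
  rw [sum_congr rfl h1]
  calc _ ≤ ∑ p : α × β,
        #{q : α × β | p.2 ≠ q.2 ∧ p.1 ≠ q.1 ∧ R q.1 p.2 ∧ R p.1 p.2 ∧ R p.1 q.2} :=
        sum_le_sum_of_subset (filter_subset _ _)
    _ = ∑ q : α × β,
        #{p : α × β | p.2 ≠ q.2 ∧ p.1 ≠ q.1 ∧ R q.1 p.2 ∧ R p.1 p.2 ∧ R p.1 q.2} :=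
        sum_card_bipartiteAbove_eq_sum_card_bipartiteBelow
          (fun p q : α × β => p.2 ≠ q.2 ∧ p.1 ≠ q.1 ∧ R q.1 p.2 ∧ R p.1 p.2 ∧ R p.1 q.2)
    _ ≤ ∑ q : α × β, 2 := sum_le_sum fun q _ => card_paths_le_two h4 h3 q.1 q.2
    _ = _ := by simp [mul_comm]

open scoped Classical in
/-- Few edges meet an element of `α` of degree less than `t`. -/
theorem card_filter_degree_lt_le {α β : Type*} [Fintype α] [Fintype β] (R : α → β → Prop)
    (t : ℝ) (ht : 0 ≤ t) :
    (#{p : α × β | R p.1 p.2 ∧ (#{b | R p.1 b} : ℝ) < t} : ℝ) ≤ Fintype.card α * t := by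
  have h := card_eq_sum_card_fiberwise (s := {p : α × β | R p.1 p.2 ∧ (#{b | R p.1 b} : ℝ) < t})
    (t := univ) (f := Prod.fst) (fun _ _ => by simp)
  rw [h]
  push_cast
  rw [← nsmul_eq_mul, ← card_univ]
  refine sum_le_card_nsmul _ _ _ fun a _ => ?_
  by_cases ha : (#{b | R a b} : ℝ) < t
  · refine le_trans ?_ ha.le
    rw [Nat.cast_le]
    refine card_le_card_of_injOn Prod.snd ?_ ?_
    · rintro ⟨a', b⟩ hp
      simp only [coe_filter, mem_filter, mem_univ, true_and, Set.mem_ofPred_eq] at hp ⊢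
      obtain ⟨⟨hp, -⟩, rfl⟩ := hp
      exact hp
    · rintro ⟨a1, b1⟩ h1 ⟨a2, b2⟩ h2 h
      simp_all
  · rw [card_eq_zero.2]
    · simpa using ht
    · rw [filter_eq_empty_iff]
      rintro ⟨a', b⟩ hp rfl
      exact ha (by simpa using (mem_filter.1 hp).2.2)

open scoped Classical in
theorem card_pow_three_le {α β : Type*} [Fintype α] [Fintype β] {R : α → β → Prop}
    (h4 : RectangleFree R) (h3 : ThetaFree R) (hα : 0 < Fintype.card α) (hβ : 0 < Fintype.card β)
    (hαe : 8 * Fintype.card α ≤ #{p : α × β | R p.1 p.2})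
    (hβe : 8 * Fintype.card β ≤ #{p : α × β | R p.1 p.2}) :
    (#{p : α × β | R p.1 p.2} : ℝ) ^ 3 ≤ 256 * (Fintype.card α * Fintype.card β : ℝ) ^ 2 := by
  set E : Finset (α × β) := {p : α × β | R p.1 p.2} with hE
  set e : ℝ := (#E : ℝ) with he
  have hn : (0 : ℝ) < Fintype.card α := by exact_mod_cast hα
  have hm : (0 : ℝ) < Fintype.card β := by exact_mod_cast hβ
  have hne : 8 * (Fintype.card α : ℝ) ≤ e := by rw [he]; exact_mod_cast hαe
  have hme : 8 * (Fintype.card β : ℝ) ≤ e := by rw [he]; exact_mod_cast hβe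
  set n : ℝ := (Fintype.card α : ℝ)
  set m : ℝ := (Fintype.card β : ℝ)
  have he0 : 0 < e := by linarith
  -- The thresholds are a quarter of the average degrees, so discarding edges at low-degree vertices
  -- costs at most `e/4` per side. Being at least 2, they satisfy `s - 1 ≥ s/2` and `t - 1 ≥ t/2`.
  have hs : 2 ≤ e / (4 * n) := by rw [le_div_iff₀ (by positivity)]; linarith
  have ht : 2 ≤ e / (4 * m) := by rw [le_div_iff₀ (by positivity)]; linarith
  set s := e / (4 * n) with hs'
  set t := e / (4 * m) with ht'
  let A : Finset (α × β) := {p | R p.1 p.2 ∧ (#{b | R p.1 b} : ℝ) < s}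
  let B : Finset (α × β) := {p | R p.1 p.2 ∧ (#{a | R a p.2} : ℝ) < t}
  have hA : (#A : ℝ) ≤ e / 4 := by
    refine (card_filter_degree_lt_le R s (by linarith)).trans_eq ?_
    change n * s = e / 4
    rw [hs']; field_simp
  have hB : (#B : ℝ) ≤ e / 4 := by
    have h := card_filter_degree_lt_le (fun b a => R a b) t (by linarith)
    refine le_trans (Nat.cast_le.2 ?_) (h.trans_eq (?_ : m * t = e / 4))
    · refine card_le_card_of_injOn Prod.swap (fun p hp => ?_) Prod.swap_injective.injOn
      simpa [B] using hp
    · rw [ht']; field_simp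
  let D := E \ (A ∪ B)
  have hD : e / 2 ≤ #D := by
    have h1 : #E ≤ #D + (#A + #B) :=
      (card_le_card_sdiff_add_card).trans (Nat.add_le_add_left (card_union_le _ _) _)
    have h2 : e ≤ #D + (#A + #B) := by rw [he]; exact_mod_cast h1
    linarith
  have key : (#D : ℝ) * ((s / 2) * (t / 2)) ≤ 2 * (n * m) := by
    have h := sum_degree_sub_one_le h4 h3
    have h' : ((∑ p ∈ E, (#{b | R p.1 b} - 1) * (#{a | R a p.2} - 1) : ℕ) : ℝ) ≤ 2 * (n * m) := by
      simp only [n, m]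
      exact_mod_cast h
    refine le_trans ?_ h'
    refine le_trans ?_ (Nat.cast_le.2 (sum_le_sum_of_subset (sdiff_subset (t := A ∪ B))))
    rw [← nsmul_eq_mul]
    push_cast
    refine card_nsmul_le_sum _ _ _ fun p hp => ?_
    have hp' : s ≤ (#{b | R p.1 b} : ℝ) ∧ t ≤ (#{a | R a p.2} : ℝ) := by
      simp only [D, A, B, E, mem_sdiff, mem_union, mem_filter, mem_univ, true_and] at hp
      push Not at hp
      exact ⟨hp.2.1 hp.1, hp.2.2 hp.1⟩
    have h1 : 1 ≤ #{b | R p.1 b} := by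
      have : (1 : ℝ) ≤ #{b | R p.1 b} := by linarith
      exact_mod_cast this
    have h2 : 1 ≤ #{a | R a p.2} := by
      have : (1 : ℝ) ≤ #{a | R a p.2} := by linarith
      exact_mod_cast this
    rw [Nat.cast_sub h1, Nat.cast_sub h2, Nat.cast_one]
    exact mul_le_mul (by linarith) (by linarith) (by linarith) (by linarith)
  have h5 : e / 2 * ((s / 2) * (t / 2)) ≤ 2 * (n * m) :=
    (mul_le_mul_of_nonneg_right hD (by positivity)).trans key
  have h6 : e / 2 * ((s / 2) * (t / 2)) = e ^ 3 / (128 * (n * m)) := by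
    rw [hs', ht']; field_simp; norm_num
  rw [h6, div_le_iff₀ (by positivity)] at h5
  linarith

/-! ### The lower bound: a norm-form incidence graph. -/

section construction

variable {F : Type*} [Field F]

/-- Incidence of `(c, u)` with `(t, v)`: `v + u` equals
`(t N(c₀, c₁) + t² N(c₂, c₃), t c₀, t c₁, t² c₂, t² c₃)` for the form `N(x, y) = x² - r y²`. -/
def normIncidence (r : F) (T : Finset F) (a : (Fin 4 → F) × (Fin 5 → F)) (b : T × (Fin 5 → F)) :
    Prop :=
  b.2 + a.2 = ![b.1 * (a.1 0 ^ 2 - r * a.1 1 ^ 2) + b.1 ^ 2 * (a.1 2 ^ 2 - r * a.1 3 ^ 2),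
    b.1 * a.1 0, b.1 * a.1 1, b.1 ^ 2 * a.1 2, b.1 ^ 2 * a.1 3]

theorem normIncidence_iff {r : F} {T : Finset F} {a : (Fin 4 → F) × (Fin 5 → F)}
    {b : T × (Fin 5 → F)} : normIncidence r T a b ↔
      b.2 0 + a.2 0 = b.1 * (a.1 0 ^ 2 - r * a.1 1 ^ 2) + b.1 ^ 2 * (a.1 2 ^ 2 - r * a.1 3 ^ 2) ∧
      b.2 1 + a.2 1 = b.1 * a.1 0 ∧ b.2 2 + a.2 2 = b.1 * a.1 1 ∧
      b.2 3 + a.2 3 = b.1 ^ 2 * a.1 2 ∧ b.2 4 + a.2 4 = b.1 ^ 2 * a.1 3 := by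
  unfold normIncidence
  rw [funext_iff]
  simp [Fin.forall_fin_succ]

theorem normIncidence_eq_right {r : F} {T : Finset F} {a : (Fin 4 → F) × (Fin 5 → F)}
    {b b' : T × (Fin 5 → F)} (h : normIncidence r T a b) (h' : normIncidence r T a b')
    (hb : (b.1 : F) = b'.1) : b = b' := by
  refine Prod.ext (Subtype.ext hb) (add_right_cancel (b := a.2) ?_)
  unfold normIncidence at h h'
  rw [h, h', hb]

theorem normIncidence_eq_left {r : F} {T : Finset F} {a a' : (Fin 4 → F) × (Fin 5 → F)}
    {b : T × (Fin 5 → F)} (h : normIncidence r T a b) (h' : normIncidence r T a' b)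
    (ha : a.1 = a'.1) : a = a' := by
  refine Prod.ext ha (add_left_cancel (a := b.2) ?_)
  unfold normIncidence at h h'
  rw [h, h', ha]

/-- Distinct elements of `T` differ in their squares. -/
def SqSeparated (T : Finset F) : Prop := ∀ t ∈ T, ∀ s ∈ T, t ≠ s → t + s ≠ 0

/-- Alternating sums around a 4-cycle give `(t - t')(c - c') = 0` in the linear coordinates and `(t²
- t'²)(c - c') = 0` in the quadratic ones; both factors in `t` are nonzero. -/
theorem normIncidence_rectangleFree (r : F) {T : Finset F} (hT : SqSeparated T) :
    RectangleFree (normIncidence r T) := by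
  intro a a' b b' h1 h2 h3 h4
  by_cases hb : (b.1 : F) = b'.1
  · exact Or.inr (normIncidence_eq_right h1 h2 hb)
  left
  have hs : (b.1 : F) + b'.1 ≠ 0 := hT _ b.1.2 _ b'.1.2 hb
  have hd : (b.1 : F) - b'.1 ≠ 0 := sub_ne_zero.2 hb
  refine normIncidence_eq_left h1 h3 ?_
  rw [normIncidence_iff] at h1 h2 h3 h4
  obtain ⟨-, p1, p2, p3, p4⟩ := h1
  obtain ⟨-, q1, q2, q3, q4⟩ := h2
  obtain ⟨-, r1, r2, r3, r4⟩ := h3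
  obtain ⟨-, s1, s2, s3, s4⟩ := h4
  have e0 : a.1 0 = a'.1 0 := by
    refine mul_left_cancel₀ hd ?_
    linear_combination q1 - p1 + r1 - s1
  have e1 : a.1 1 = a'.1 1 := by
    refine mul_left_cancel₀ hd ?_
    linear_combination q2 - p2 + r2 - s2
  have e2 : a.1 2 = a'.1 2 := by
    refine mul_left_cancel₀ (mul_ne_zero hd hs) ?_
    linear_combination q3 - p3 + r3 - s3
  have e3 : a.1 3 = a'.1 3 := by
    refine mul_left_cancel₀ (mul_ne_zero hd hs) ?_
    linear_combination q4 - p4 + r4 - s4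
  funext i
  fin_cases i
  exacts [e0, e1, e2, e3]

theorem sq_sub_mul_sq_eq_zero {r x y : F} (hr : ¬ IsSquare r) (h : x ^ 2 - r * y ^ 2 = 0) :
    x = 0 ∧ y = 0 := by
  have hy : y = 0 := by
    by_contra hy
    refine hr ⟨x / y, ?_⟩
    field_simp
    linear_combination -h
  subst hy
  simpa using h

/-- A quadratic polynomial with three distinct roots vanishes. -/
theorem quadratic_eq_zero {A B C : F} {s : Fin 3 → F} (hs : Injective s)
    (h : ∀ i, A * s i ^ 2 + B * s i + C = 0) : A = 0 ∧ B = 0 ∧ C = 0 := by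
  have h01 : s 0 - s 1 ≠ 0 := sub_ne_zero.2 (hs.ne (by decide))
  have h02 : s 0 - s 2 ≠ 0 := sub_ne_zero.2 (hs.ne (by decide))
  have h12 : s 1 - s 2 ≠ 0 := sub_ne_zero.2 (hs.ne (by decide))
  have k1 : A * (s 0 + s 1) + B = 0 := by
    refine mul_left_cancel₀ h01 ?_
    linear_combination h 0 - h 1
  have k2 : A * (s 0 + s 2) + B = 0 := by
    refine mul_left_cancel₀ h02 ?_
    linear_combination h 0 - h 2
  have hA : A = 0 := by
    refine mul_left_cancel₀ h12 ?_
    linear_combination k1 - k2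
  have hB : B = 0 := by simpa [hA] using k1
  exact ⟨hA, hB, by simpa [hA, hB] using h 0⟩

theorem normIncidence_thetaFree {r : F} (hr : ¬ IsSquare r) {T : Finset F} (hT : SqSeparated T) :
    ThetaFree (normIncidence r T) := by
  intro a b x y hx hy h
  set t : F := b.1.1 with ht
  let s : Fin 3 → F := fun i => (x i).1
  have hsinj : Injective s := fun i j hij =>
    hx (normIncidence_eq_right (h i).2.2.1 (h j).2.2.1 hij)
  have hne : ∀ i, t - s i ≠ 0 := fun i h0 => by
    obtain ⟨h1, h2, h3, h4, h5⟩ := h i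
    exact h1 (normIncidence_eq_right h4 h5 (sub_eq_zero.1 h0).symm)
  have hne' : ∀ i, t + s i ≠ 0 := fun i =>
    hT _ b.1.2 _ (x i).1.2 (sub_ne_zero.1 (hne i))
  -- the difference `w` of the two sides of the incidence equations of `a` and `b`
  set w : Fin 5 → F := ![b.2 0 + a.2 0 - (t * (a.1 0 ^ 2 - r * a.1 1 ^ 2)
      + t ^ 2 * (a.1 2 ^ 2 - r * a.1 3 ^ 2)),
    b.2 1 + a.2 1 - t * a.1 0, b.2 2 + a.2 2 - t * a.1 1,
    b.2 3 + a.2 3 - t ^ 2 * a.1 2, b.2 4 + a.2 4 - t ^ 2 * a.1 3] with hw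
  have w0 : w 0 = b.2 0 + a.2 0 - (t * (a.1 0 ^ 2 - r * a.1 1 ^ 2)
      + t ^ 2 * (a.1 2 ^ 2 - r * a.1 3 ^ 2)) := rfl
  have w1 : w 1 = b.2 1 + a.2 1 - t * a.1 0 := rfl
  have w2 : w 2 = b.2 2 + a.2 2 - t * a.1 1 := rfl
  have w3 : w 3 = b.2 3 + a.2 3 - t ^ 2 * a.1 2 := rfl
  have w4 : w 4 = b.2 4 + a.2 4 - t ^ 2 * a.1 3 := rfl
  clear_value w
  -- Alternating sums along the `i`-th path eliminate the vectors of `x i` and `y i`, so `w` does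
  -- not depend on `i`.
  have d : ∀ i, w 1 = (t - s i) * ((y i).1 0 - a.1 0) ∧ w 2 = (t - s i) * ((y i).1 1 - a.1 1) ∧
      w 3 = (t ^ 2 - s i ^ 2) * ((y i).1 2 - a.1 2) ∧
      w 4 = (t ^ 2 - s i ^ 2) * ((y i).1 3 - a.1 3) ∧
      w 0 = (t - s i) * ((y i).1 0 ^ 2 - r * (y i).1 1 ^ 2 - (a.1 0 ^ 2 - r * a.1 1 ^ 2)) +
        (t ^ 2 - s i ^ 2) * ((y i).1 2 ^ 2 - r * (y i).1 3 ^ 2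
          - (a.1 2 ^ 2 - r * a.1 3 ^ 2)) := by
    intro i
    obtain ⟨-, -, h1, h2, h3⟩ := h i
    rw [normIncidence_iff] at h1 h2 h3
    obtain ⟨p0, p1, p2, p3, p4⟩ := h1
    obtain ⟨q0, q1, q2, q3, q4⟩ := h2
    obtain ⟨r0, r1, r2, r3, r4⟩ := h3
    refine ⟨?_, ?_, ?_, ?_, ?_⟩
    · linear_combination w1 + p1 - q1 + r1
    · linear_combination w2 + p2 - q2 + r2
    · linear_combination w3 + p3 - q3 + r3
    · linear_combination w4 + p4 - q4 + r4
    · linear_combination w0 + p0 - q0 + r0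
  -- Completing the square: subtracting the polar terms of the form turns the differences of norms
  -- in `w 0` into norms of differences.
  set e := w 0 - 2 * (w 1 * a.1 0 - r * (w 2 * a.1 1)) - 2 * (w 3 * a.1 2 - r * (w 4 * a.1 3))
    with he
  -- With `N₁`, `N₂` the norms of `(w 1, w 2)` and `(w 3, w 4)`, this is `e = N₁ / (t - s) + N₂ /
  -- (t² - s²)` cleared of denominators.
  have quad : ∀ i, e * s i ^ 2 + (w 1 ^ 2 - r * w 2 ^ 2) * s i +
      ((w 1 ^ 2 - r * w 2 ^ 2) * t + (w 3 ^ 2 - r * w 4 ^ 2) - e * t ^ 2) = 0 := by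
    intro i
    obtain ⟨d1, d2, d3, d4, d0⟩ := d i
    rw [he, d0, d1, d2, d3, d4]
    ring
  obtain ⟨he0, hN1, hC⟩ := quadratic_eq_zero hsinj quad
  rw [he0, hN1] at hC
  obtain ⟨z1, z2⟩ := sq_sub_mul_sq_eq_zero hr hN1
  obtain ⟨z3, z4⟩ := sq_sub_mul_sq_eq_zero hr (x := w 3) (y := w 4) (by simpa using hC)
  obtain ⟨d1, d2, d3, d4, -⟩ := d 0
  have hsq : t ^ 2 - s 0 ^ 2 ≠ 0 := by
    rw [sq_sub_sq]
    exact mul_ne_zero (hne' 0) (hne 0)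
  rw [z1, zero_eq_mul, or_iff_right (hne 0), sub_eq_zero] at d1
  rw [z2, zero_eq_mul, or_iff_right (hne 0), sub_eq_zero] at d2
  rw [z3, zero_eq_mul, or_iff_right hsq, sub_eq_zero] at d3
  rw [z4, zero_eq_mul, or_iff_right hsq, sub_eq_zero] at d4
  obtain ⟨h1, h2, h3, h4, h5⟩ := h 0
  refine h2 (normIncidence_eq_left h4 h3 ?_)
  funext i
  fin_cases i
  exacts [d1, d2, d3, d4]

open scoped Classical in
-- For each `t` and each left vertex the defining equation has one solution `v`, so every left
-- vertex has degree `#T`.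
theorem card_normIncidence [Fintype F] (r : F) (T : Finset F) :
    #T * Fintype.card F ^ 9 ≤
      #{p : ((Fin 4 → F) × (Fin 5 → F)) × (T × (Fin 5 → F)) | normIncidence r T p.1 p.2} := by
  let f : T × ((Fin 4 → F) × (Fin 5 → F)) → ((Fin 4 → F) × (Fin 5 → F)) × (T × (Fin 5 → F)) :=
    fun p => (p.2, (p.1, ![p.1 * (p.2.1 0 ^ 2 - r * p.2.1 1 ^ 2) +
      p.1 ^ 2 * (p.2.1 2 ^ 2 - r * p.2.1 3 ^ 2),
      p.1 * p.2.1 0, p.1 * p.2.1 1, p.1 ^ 2 * p.2.1 2, p.1 ^ 2 * p.2.1 3] - p.2.2))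
  have h := card_le_card_of_injOn (s := univ)
    (t := {p : ((Fin 4 → F) × (Fin 5 → F)) × (T × (Fin 5 → F)) | normIncidence r T p.1 p.2})
    f (fun p _ => by
      rw [mem_coe, mem_filter]
      exact ⟨mem_univ _, sub_add_cancel _ _⟩)
    (fun p _ q _ hpq => Prod.ext (congrArg (fun z => z.2.1) hpq) (congrArg Prod.fst hpq))
  refine le_trans (le_of_eq ?_) h
  simp only [card_univ, Fintype.card_prod, Fintype.card_coe, Fintype.card_fun, Fintype.card_fin]
  ring

end construction

/-! ### Choice of parameters and asymptotics. -/

theorem exists_sqSeparated (p : ℕ) [Fact p.Prime] :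
    ∃ T : Finset (ZMod p), #T = (p - 1) / 2 ∧ SqSeparated T := by
  have hp : 0 < p := (Fact.out : p.Prime).pos
  have hinj : ∀ i j : ℕ, i < p → j < p → (i : ZMod p) = j → i = j := by
    intro i j hi hj h
    rw [ZMod.natCast_eq_natCast_iff] at h
    exact h.eq_of_lt_of_lt hi hj
  -- The sum of two elements of `[1, (p - 1) / 2]` lies strictly between `0` and `p`.
  refine ⟨(Icc 1 ((p - 1) / 2)).image (fun i : ℕ => (i : ZMod p)), ?_, ?_⟩
  · rw [card_image_of_injOn]
    · simp
    · intro i hi j hj h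
      simp only [coe_Icc, Set.mem_Icc] at hi hj
      exact hinj i j (by omega) (by omega) h
  · intro t ht s hs _ h
    simp only [mem_image, mem_Icc] at ht hs
    obtain ⟨i, hi, rfl⟩ := ht
    obtain ⟨j, hj, rfl⟩ := hs
    have := hinj (i + j) 0 (by omega) hp (by simpa using h)
    omega

theorem pow_mul_le_ex {p n m : ℕ} (hp : p.Prime) (hp2 : p ≠ 2) (hn : p ^ 9 ≤ n) (hm : p ^ 6 ≤ m) :
    (p - 1) / 2 * p ^ 9 ≤ ex n m cycleThetaFamily := by
  classical
  have := Fact.mk hp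
  obtain ⟨T, hT, hsep⟩ := exists_sqSeparated p
  obtain ⟨r, hr⟩ := FiniteField.exists_nonsquare (F := ZMod p) (by rwa [ZMod.ringChar_zmod_n])
  have h := card_normIncidence r T
  rw [hT, ZMod.card] at h
  refine h.trans (card_le_ex ?_ ?_ (normIncidence_rectangleFree r hsep)
    (normIncidence_thetaFree hr hsep))
  · simp only [Fintype.card_prod, Fintype.card_fun, Fintype.card_fin, ZMod.card, ← pow_add]
    exact hn
  · simp only [Fintype.card_prod, Fintype.card_fun, Fintype.card_fin, ZMod.card, Fintype.card_coe]
    refine le_trans ?_ hm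
    rw [pow_succ' p 5]
    exact Nat.mul_le_mul_right _ (by omega)

theorem one_le_ex {n m : ℕ} (hn : 1 ≤ n) (hm : 1 ≤ m) : 1 ≤ ex n m cycleThetaFamily := by
  classical
  have := card_le_ex (α := Unit) (β := Unit) (R := fun _ _ => True) (by simpa using hn)
    (by simpa using hm) (fun _ _ _ _ _ _ _ _ => Or.inl rfl)
    (fun _ _ _ _ _ _ h => (h 0).1 rfl)
  simpa using this

theorem le_of_eq_floor_or_ceil {x : ℝ} {m : ℕ} (hx : 1 ≤ x) (hm : m = ⌊x⌋₊ ∨ m = ⌈x⌉₊) :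
    1 ≤ m ∧ ⌊x⌋₊ ≤ m ∧ m ≤ ⌈x⌉₊ ∧ (m : ℝ) ≤ 2 * x := by
  have h1 : 1 ≤ ⌊x⌋₊ := Nat.le_floor (by simpa using hx)
  have h2 : ⌊x⌋₊ ≤ ⌈x⌉₊ := Nat.floor_le_ceil x
  have h3 : (⌈x⌉₊ : ℝ) ≤ 2 * x := by linarith [Nat.ceil_lt_add_one (zero_le_one.trans hx)]
  have h4 : (⌊x⌋₊ : ℝ) ≤ ⌈x⌉₊ := by exact_mod_cast h2
  rcases hm with rfl | rfl
  · exact ⟨h1, le_rfl, h2, h4.trans h3⟩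
  · exact ⟨h1.trans h2, h2, le_rfl, h3⟩

theorem ex_le {n m : ℕ} {x : ℝ} (hx : 1 ≤ x) (hn : (n : ℝ) = x ^ 9) (hm1 : 1 ≤ m)
    (hmn : m ≤ n) (hm : (m : ℝ) ≤ 2 * x ^ 6) :
    (ex n m cycleThetaFamily : ℝ) ≤ 11 * x ^ 10 := by
  classical
  have hx0 : 0 ≤ x := zero_le_one.trans hx
  have hpos : 0 ≤ 11 * x ^ 10 := by positivity
  refine le_trans (Nat.cast_le.2 (ex_le_of_forall fun R h4 h3 => Nat.le_floor ?_))
    (Nat.floor_le hpos)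
  by_cases h8 : 8 * n ≤ #{p : Fin n × Fin m | R p.1 p.2}
  · have h := card_pow_three_le h4 h3 (by simp; omega) (by simp; omega) (by simpa using h8)
      (by simp only [Fintype.card_fin]; omega)
    simp only [Fintype.card_fin] at h
    refine le_of_pow_le_pow_left₀ (n := 3) (by norm_num) hpos (le_trans (by convert h) ?_)
    -- The factor 4 from `m ≤ 2x⁶` makes the constant 1024, and `11³ = 1331` is the next cube.
    calc 256 * ((n : ℝ) * m) ^ 2 ≤ 256 * (x ^ 9 * (2 * x ^ 6)) ^ 2 := by rw [hn]; gcongr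
      _ = 1024 * x ^ 30 := by ring
      _ ≤ 1331 * x ^ 30 := by gcongr; norm_num
      _ = (11 * x ^ 10) ^ 3 := by ring
  · have h : (#{p : Fin n × Fin m | R p.1 p.2} : ℝ) ≤ 8 * n := by exact_mod_cast (not_le.1 h8).le
    calc _ ≤ 8 * (n : ℝ) := by convert h
      _ = 8 * x ^ 9 := by rw [hn]
      _ ≤ 11 * x ^ 10 := by
        gcongr <;> norm_num

theorem le_ex {n m : ℕ} {x : ℝ} (hx : 1 ≤ x) (hn : (n : ℝ) = x ^ 9) (hm1 : 1 ≤ m)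
    (hm : ⌊x ^ 6⌋₊ ≤ m) :
    1 / 4 ^ 10 * x ^ 10 ≤ (ex n m cycleThetaFamily : ℝ) := by
  have hx0 : 0 ≤ x := zero_le_one.trans hx
  have hn1 : 1 ≤ n := by
    have : (1 : ℝ) ≤ n := hn ▸ one_le_pow₀ hx
    exact_mod_cast this
  have hlt := Nat.lt_floor_add_one x
  by_cases h4 : 4 ≤ ⌊x⌋₊
  -- Bertrand's postulate at `⌊x⌋ / 2 ≥ 2` gives an odd prime with `p ≤ x ≤ 2p`.
  · obtain ⟨p, hp, h1, h2⟩ := Nat.exists_prime_lt_and_le_two_mul (⌊x⌋₊ / 2) (by omega)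
    have hpx : (p : ℝ) ≤ x :=
      (Nat.cast_le.2 (by omega : p ≤ ⌊x⌋₊)).trans (Nat.floor_le hx0)
    have hxp : x ≤ 2 * p := by
      have h : ((⌊x⌋₊ + 1 : ℕ) : ℝ) ≤ ((2 * p : ℕ) : ℝ) := Nat.cast_le.2 (by omega)
      push_cast at h
      linarith
    have hp9 : p ^ 9 ≤ n := by
      have : (p : ℝ) ^ 9 ≤ n := by rw [hn]; gcongr
      exact_mod_cast this
    have hp6 : p ^ 6 ≤ m := by
      refine le_trans (Nat.le_floor ?_) hm
      push_cast
      gcongr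
    have hodd : p % 2 = 1 := hp.eq_two_or_odd.resolve_left (by omega)
    have hcard := pow_mul_le_ex hp (by omega) hp9 hp6
    have h3 : p * p ^ 9 ≤ 3 * ex n m cycleThetaFamily :=
      calc p * p ^ 9 ≤ 3 * ((p - 1) / 2) * p ^ 9 := Nat.mul_le_mul_right _ (by omega)
        _ = 3 * ((p - 1) / 2 * p ^ 9) := by ring
        _ ≤ _ := Nat.mul_le_mul_left _ hcard
    have h3' : (p : ℝ) * p ^ 9 ≤ 3 * ex n m cycleThetaFamily := by exact_mod_cast h3
    calc 1 / 4 ^ 10 * x ^ 10 ≤ 1 / 4 ^ 10 * (2 * (p : ℝ)) ^ 10 := by gcongr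
      _ = 1 / 1024 * ((p : ℝ) * p ^ 9) := by ring
      _ ≤ 1 / 1024 * (3 * ex n m cycleThetaFamily) := by gcongr
      _ ≤ ex n m cycleThetaFamily := by
        have : (0 : ℝ) ≤ ex n m cycleThetaFamily := Nat.cast_nonneg _
        linarith
  -- For small `x` a single edge suffices; this fixes the constant `1 / 4 ^ 10`.
  · have hx4 : x ≤ 4 := by
      have h : ((⌊x⌋₊ + 1 : ℕ) : ℝ) ≤ ((4 : ℕ) : ℝ) := Nat.cast_le.2 (by omega)
      push_cast at h
      linarith
    calc 1 / 4 ^ 10 * x ^ 10 ≤ 1 / 4 ^ 10 * 4 ^ 10 := by gcongr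
      _ = 1 := by norm_num
      _ ≤ ex n m cycleThetaFamily := by exact_mod_cast one_le_ex hn1 hm1

end BipartiteTuran

theorem mainTheorem6 :
    ∃ c C : ℝ, 0 < c ∧ 0 < C ∧ ∀ n : ℕ, 1 ≤ n → ∀ m : ℕ,
      (m = ⌊(n : ℝ) ^ (2 / 3 : ℝ)⌋₊ ∨ m = ⌈(n : ℝ) ^ (2 / 3 : ℝ)⌉₊) →
        c * (n : ℝ) ^ (1 + 1 / 9 : ℝ) ≤
            (BipartiteTuran.ex n m
              {⟨_, SimpleGraph.cycleGraph 4⟩, ⟨_, BipartiteTuran.thetaGraph 3 3⟩} : ℝ) ∧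
          (BipartiteTuran.ex n m
              {⟨_, SimpleGraph.cycleGraph 4⟩, ⟨_, BipartiteTuran.thetaGraph 3 3⟩} : ℝ) ≤
            C * (n : ℝ) ^ (1 + 1 / 9 : ℝ) := by
  refine ⟨1 / 4 ^ 10, 11, by positivity, by norm_num, fun n hn m hm => ?_⟩
  have hn1 : (1 : ℝ) ≤ n := by exact_mod_cast hn
  have hn0 : (0 : ℝ) ≤ n := Nat.cast_nonneg n
  -- In terms of `x = n^(1/9)` all exponents become the integers 9, 6 and 10.
  obtain ⟨x, hx⟩ : ∃ x : ℝ, x = (n : ℝ) ^ (1 / 9 : ℝ) := ⟨_, rfl⟩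
  have hx1 : 1 ≤ x := hx ▸ Real.one_le_rpow hn1 (by norm_num)
  have h9 : (n : ℝ) = x ^ 9 := by
    rw [hx, ← Real.rpow_mul_natCast hn0]; norm_num
  have h6 : (n : ℝ) ^ (2 / 3 : ℝ) = x ^ 6 := by
    rw [hx, ← Real.rpow_mul_natCast hn0]; norm_num
  have h10 : (n : ℝ) ^ (1 + 1 / 9 : ℝ) = x ^ 10 := by
    rw [hx, ← Real.rpow_mul_natCast hn0]; norm_num
  rw [h6] at hm
  rw [h10]
  obtain ⟨hm1, hfl, hce, hm2⟩ := BipartiteTuran.le_of_eq_floor_or_ceil (one_le_pow₀ hx1) hm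
  refine ⟨BipartiteTuran.le_ex hx1 h9 hm1 hfl, BipartiteTuran.ex_le hx1 h9 hm1 ?_ hm2⟩
  refine hce.trans (Nat.ceil_le.2 ?_)
  rw [h9]
  exact pow_le_pow_right₀ hx1 (by norm_num)
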